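/- Let $(R,\mathfrak m)$ be a regular local ring (not necessarily complete, possibly of mixed characteristic) with a regular system of parameters $x=(x_1,\dots,x_n)$, where $n=\dim R$, and let $\widehat R$ be the $\mathfrak m$-adic completion of $R$. Every $f\in R$ has a finite expansion $f=\sum_A \rho_A x^A$ with $A\in\mathbb Z_{\ge 0}^n$ and $\rho_A\in R^\times\cup\{0\}$; the Newton polyhedron $\operatorname{NP}(f)=\operatorname{NP}(f,x)$ is the smallest closed convex subset of $\mathbb R^n$ containing $\{A \mid \rho_A\neq 0\}+\mathbb R^n_{\ge 0}$ (the statement holds for the set computed from any such expansion). A compact face of $\operatorname{NP}(f)$ is the set of all points of $\operatorname{NP}(f)$ where some linear form $L(v)=c_1v_1+\dots+c_nv_n$ with all $c_i>0$ attains its minimum over $\operatorname{NP}(f)$. Its dimension is the dimension of its affine span. A vertex is a compact face of dimension $0$, and a loose edge is a compact face of dimension $1$ that is not contained in any compact face of dimension $\ge 2$. Corollary 1.2. Let $f\in R$. If $\operatorname{NP}(f)$ has a loose edge and at least three vertices, then (the image of) $f$ is not irreducible in $\widehat R$. -/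

import Mathlib

open scoped Pointwise

/-- `x = (x₁, …, xₙ)` is a regular system of parameters of the regular local ring `R`:
the `xᵢ` generate the maximal ideal, and `n` is the Krull dimension of `R`. -/
def IsRegularSystemOfParameters {R : Type*} [CommRing R] [IsRegularLocalRing R] {n : ℕ}
    (x : Fin n → R) : Prop :=
  Ideal.span (Set.range x) = IsLocalRing.maximalIdeal R ∧ ringKrullDim R = n

/-- `p` records a finite expansion `f = ∑_A ρ_A x^A` in which every coefficient `ρ_A` is
zero or a unit of `R`; here `ρ_A = p.coeff A` and `x^A = x₁^{A₁} ⋯ xₙ^{Aₙ}`. -/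
def IsUnitExpansion {R : Type*} [CommRing R] {n : ℕ} (x : Fin n → R) (f : R)
    (p : MvPolynomial (Fin n) R) : Prop :=
  MvPolynomial.eval x p = f ∧ ∀ A : Fin n →₀ ℕ, p.coeff A = 0 ∨ IsUnit (p.coeff A)

/-- The exponents `A ∈ ℤⁿ_{≥0}` with `ρ_A ≠ 0`, as points of `ℝⁿ`. -/
def exponentPoints {R : Type*} [CommRing R] {n : ℕ} (p : MvPolynomial (Fin n) R) :
    Set (Fin n → ℝ) :=
  {v | ∃ A : Fin n →₀ ℕ, p.coeff A ≠ 0 ∧ v = fun i => (A i : ℝ)}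

/-- `Δ` is the Newton polyhedron of `f` with respect to `x`: for a finite expansion
`f = ∑_A ρ_A x^A` with coefficients in `R^× ∪ {0}`, it is the smallest closed convex set
containing `{A | ρ_A ≠ 0} + ℝⁿ_{≥0}`. -/
def IsNewtonPolyhedron {R : Type*} [CommRing R] {n : ℕ} (x : Fin n → R) (f : R)
    (Δ : Set (Fin n → ℝ)) : Prop :=
  ∃ p : MvPolynomial (Fin n) R, IsUnitExpansion x f p ∧
    Δ = closedConvexHull ℝ (exponentPoints p + {v : Fin n → ℝ | ∀ i, 0 ≤ v i})

/-- `F` is a compact face of the closed convex set `Δ ⊆ ℝⁿ_{≥0}` (with `Δ + ℝⁿ_{≥0} = Δ`): it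
is the nonempty set of those points of `Δ` at which some positive linear form
`L(v) = c₁ v₁ + ⋯ + cₙ vₙ`, all `cᵢ > 0`, attains its minimum on `Δ`. -/
def IsCompactFace {n : ℕ} (Δ F : Set (Fin n → ℝ)) : Prop :=
  F.Nonempty ∧ ∃ c : Fin n → ℝ, (∀ i, 0 < c i) ∧
    F = {v | v ∈ Δ ∧ ∀ w ∈ Δ, ∑ i, c i * v i ≤ ∑ i, c i * w i}

/-- The dimension of a convex set: the dimension of its affine span. -/
noncomputable def faceDim {n : ℕ} (F : Set (Fin n → ℝ)) : ℕ :=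
  Module.finrank ℝ (vectorSpan ℝ F)

/-- The vertices: the compact faces of dimension zero (they are one-point sets). -/
def IsVertex {n : ℕ} (Δ F : Set (Fin n → ℝ)) : Prop :=
  IsCompactFace Δ F ∧ faceDim F = 0

/-- A loose edge: a compact face of dimension one that is not contained in any compact face
of dimension at least two. -/
def IsLooseEdge {n : ℕ} (Δ E : Set (Fin n → ℝ)) : Prop :=
  IsCompactFace Δ E ∧ faceDim E = 1 ∧
    ∀ F : Set (Fin n → ℝ), IsCompactFace Δ F → 2 ≤ faceDim F → ¬ E ⊆ F

/-! Let `E` be a loose edge of the Newton polyhedron, with end points `A` and `B`.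

If a linear form constant on `E` could be tilted, staying constant on `E` and positive, until a
further exponent reaches the minimum, then `E` would lie on a larger compact face. Hence no
nonnegative form vanishing on `B - A` separates an exponent from `A`, and by a one-variable Farkas
lemma all exponents lie in the strip `A + ℝ (B - A) + ℝⁿ_{≥0}`
(`exists_endpoints_of_isLooseEdge`). If `A` and `B` had disjoint supports, every point of this
strip in the orthant would lie in `[A, B] + ℝⁿ_{≥0}`, so that `A` and `B` would be the only
vertices (`isVertex_eq_or_eq`). With three vertices, therefore, `C = A ⊓ B` is nonzero.

Write the part of `f` on the edge as `G H` with `G = x^C`; both factors lie in the maximal ideal,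
and `H` has exponents in `[P, Q]`, where `P = A - C` and `Q = B - C` have disjoint supports.
The factorization lifts to the completion by a Hensel argument
(`exists_factorization_adicCompletion`) for the filtrations by ideals `stripIdeal` spanned by the
monomials in a strip of weight at least a given bound. The linear step of that argument is
`stripIdeal_add_le`: a monomial of the strip through `A = C + P` either is a multiple of `G`,
or lies beyond one end of the edge; in the latter case dividing by the extreme term of `H`, whose
coefficient is a unit, moves it strictly towards the edge. Only the units at the two ends matter,
so no coefficient field is required and mixed characteristic plays no role. -/

/-! ### A Hensel-type lemma for filtrations by ideals -/

/-- Hensel's lemma for filtered ideals: an approximate factorization `G H` of `f` lifts to the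
`I`-adic completion, provided every error in `e k` can be written as `G y + H z` with `y ∈ b k` and
`z ∈ a k`. The filtrations need only be finer than the `I`-adic one up to the factor `M`. -/
theorem exists_factorization_adicCompletion {R : Type*} [CommRing R] {I : Ideal R}
    {a b e : ℕ → Ideal R} {f G H : R} {M : ℕ}
    (ha : Antitone a) (hb : Antitone b) (he : Antitone e)
    (hmul : ∀ i j, a i * b j ≤ e (i + j))
    (hsplit : ∀ k, e k ≤ Ideal.span {G} * b k ⊔ Ideal.span {H} * a k)
    (hf : f - G * H ∈ e 1)
    (haI : ∀ t, a (M * t + 1) ≤ I ^ (t + 1)) (hbI : ∀ t, b (M * t + 1) ≤ I ^ (t + 1))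
    (heI : ∀ t, e (M * t + 1) ≤ I ^ (t + 1)) (hG : G ∈ I) (hH : H ∈ I) :
    ∃ g h : AdicCompletion I R, algebraMap R (AdicCompletion I R) f = g * h ∧
      AdicCompletion.evalₐ I 1 g = 0 ∧ AdicCompletion.evalₐ I 1 h = 0 := by
  let S : ℕ → Type _ := fun k =>
    {q : R × R // q.1 - G ∈ a 1 ∧ q.2 - H ∈ b 1 ∧ f - q.1 * q.2 ∈ e (k + 1)}
  -- Newton step: write the error as `G y + H z` and pass to `(g + z) (h + y)`.
  have step : ∀ k, ∀ q : S k, ∃ q' : S (k + 1),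
      q'.1.1 - q.1.1 ∈ a (k + 1) ∧ q'.1.2 - q.1.2 ∈ b (k + 1) := by
    rintro k ⟨⟨g, h⟩, hg, hh, herr⟩
    obtain ⟨u, hu, v, hv, huv⟩ := Submodule.mem_sup.1 (hsplit _ herr)
    obtain ⟨y, hy, rfl⟩ := Ideal.mem_span_singleton_mul.1 hu
    obtain ⟨z, hz, rfl⟩ := Ideal.mem_span_singleton_mul.1 hv
    simp only at hg hh herr huv
    have h1 : a (k + 1) ≤ a 1 := ha (by omega)
    have h2 : b (k + 1) ≤ b 1 := hb (by omega)
    refine ⟨⟨(g + z, h + y), ?_, ?_, ?_⟩, ?_, ?_⟩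
    · have : g + z - G = (g - G) + z := by ring
      simpa only [this] using add_mem hg (h1 hz)
    · have : h + y - H = (h - H) + y := by ring
      simpa only [this] using add_mem hh (h2 hy)
    · have e1 : (g - G) * y ∈ e (k + 1 + 1) :=
        he (by omega) (hmul 1 (k + 1) (Ideal.mul_mem_mul hg hy))
      have e2 : z * (h - H) ∈ e (k + 1 + 1) :=
        he (by omega) (hmul (k + 1) 1 (Ideal.mul_mem_mul hz hh))
      have e3 : z * y ∈ e (k + 1 + 1) :=
        he (by omega) (hmul (k + 1) (k + 1) (Ideal.mul_mem_mul hz hy))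
      have : f - (g + z) * (h + y) = -((g - G) * y) - z * (h - H) - z * y := by
        linear_combination -huv
      simp only [this]
      exact sub_mem (sub_mem (neg_mem e1) e2) e3
    · simpa using hz
    · simpa using hy
  choose next hnext using step
  let s : ∀ k, S k := fun k =>
    Nat.rec ⟨(G, H), by simp, by simp, by simpa using hf⟩ next k
  have hs : ∀ k, (s (k + 1)).1.1 - (s k).1.1 ∈ a (k + 1) ∧
      (s (k + 1)).1.2 - (s k).1.2 ∈ b (k + 1) := fun k => hnext k (s k)
  have tele : ∀ m d, (s (m + d)).1.1 - (s m).1.1 ∈ a (m + 1) ∧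
      (s (m + d)).1.2 - (s m).1.2 ∈ b (m + 1) := by
    intro m d
    induction d with
    | zero => simp
    | succ d ih =>
      have h := hs (m + d)
      constructor
      · have := add_mem (ha (by omega : m + 1 ≤ m + d + 1) h.1) ih.1
        rwa [sub_add_sub_cancel] at this
      · have := add_mem (hb (by omega : m + 1 ≤ m + d + 1) h.2) ih.2
        rwa [sub_add_sub_cancel] at this
  have cg : ∀ t, (s (M * t)).1.1 ≡ (s (M * (t + 1))).1.1 [SMOD (I ^ t • ⊤ : Submodule R R)] := by
    intro t
    refine (SModEq.sub_mem.2 ?_).symm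
    rw [smul_eq_mul, Ideal.mul_top]
    exact Ideal.pow_le_pow_right (Nat.le_succ t) (haI t (tele (M * t) M).1)
  have ch : ∀ t, (s (M * t)).1.2 ≡ (s (M * (t + 1))).1.2 [SMOD (I ^ t • ⊤ : Submodule R R)] := by
    intro t
    refine (SModEq.sub_mem.2 ?_).symm
    rw [smul_eq_mul, Ideal.mul_top]
    exact Ideal.pow_le_pow_right (Nat.le_succ t) (hbI t (tele (M * t) M).2)
  have a1 : a 1 ≤ I := by simpa using haI 0
  have b1 : b 1 ≤ I := by simpa using hbI 0
  refine ⟨AdicCompletion.mk I R (.mk I R _ cg), AdicCompletion.mk I R (.mk I R _ ch), ?_, ?_, ?_⟩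
  · refine AdicCompletion.ext_evalₐ fun t => ?_
    rw [map_mul, AdicCompletion.evalₐ_mk, AdicCompletion.evalₐ_mk, AlgHom.commutes,
      Ideal.Quotient.algebraMap_eq, ← map_mul, Ideal.Quotient.eq]
    exact Ideal.pow_le_pow_right (Nat.le_succ t) (heI t (s (M * t)).2.2.2)
  · rw [AdicCompletion.evalₐ_mk, Ideal.Quotient.eq_zero_iff_mem, pow_one]
    simpa using add_mem (a1 (s (M * 1)).2.1) hG
  · rw [AdicCompletion.evalₐ_mk, Ideal.Quotient.eq_zero_iff_mem, pow_one]
    simpa using add_mem (b1 (s (M * 1)).2.2.1) hH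

theorem not_irreducible_of_evalₐ_one_eq_zero {R : Type*} [CommRing R] {I : Ideal R} (hI : I ≠ ⊤)
    {r g h : AdicCompletion I R} (hr : r = g * h) (hg : AdicCompletion.evalₐ I 1 g = 0)
    (hh : AdicCompletion.evalₐ I 1 h = 0) : ¬ Irreducible r := by
  have : Nontrivial (R ⧸ I ^ 1) := Ideal.Quotient.nontrivial_iff.2 (by simpa using hI)
  intro hirr
  rcases hirr.isUnit_or_isUnit hr with hu | hu
  · exact not_isUnit_zero (hg ▸ hu.map (AdicCompletion.evalₐ I 1))
  · exact not_isUnit_zero (hh ▸ hu.map (AdicCompletion.evalₐ I 1))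

/-! ### Ideals of monomials in a strip -/

/-- The value `x^V` of the monomial with exponent `V` at `x`. -/
def monomialValue {σ R : Type*} [Fintype σ] [CommRing R] (x : σ → R) (V : σ →₀ ℕ) : R :=
  ∏ i, x i ^ V i

/-- The weighted degree `c · V` of the exponent `V`. -/
def weight {σ : Type*} [Fintype σ] (c : σ → ℕ) (V : σ →₀ ℕ) : ℕ := ∑ i, c i * V i

/-- The ideal spanned by the monomials `x^V` with `V ∈ P + ℝ D + ℝⁿ_{≥0}` and
`c · V ≥ c · P + k`. In the applications `c` is positive and orthogonal to `D`, so that `k` measures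
the distance of `V` from the line `P + ℝ D`. The direction `D` is real-valued so that it can be a
difference of exponents without truncation. -/
def stripIdeal {σ R : Type*} [Fintype σ] [CommRing R] (x : σ → R) (D : σ → ℝ) (c : σ → ℕ)
    (P : σ →₀ ℕ) (k : ℕ) : Ideal R :=
  Ideal.span {r | ∃ V : σ →₀ ℕ, (∃ l : ℝ, ∀ i, (P i : ℝ) + l * D i ≤ V i) ∧
    weight c P + k ≤ weight c V ∧ r = monomialValue x V}

section Strip

variable {σ R : Type*} [Fintype σ] [CommRing R] {x : σ → R} {D : σ → ℝ} {c : σ → ℕ}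

theorem monomialValue_add (x : σ → R) (V W : σ →₀ ℕ) :
    monomialValue x (V + W) = monomialValue x V * monomialValue x W := by
  simp [monomialValue, pow_add, Finset.prod_mul_distrib]

theorem weight_add (c : σ → ℕ) (V W : σ →₀ ℕ) : weight c (V + W) = weight c V + weight c W := by
  simp [weight, mul_add, Finset.sum_add_distrib]

theorem monomialValue_mem_pow {I : Ideal R} (hx : ∀ i, x i ∈ I) (V : σ →₀ ℕ) :
    monomialValue x V ∈ I ^ ∑ i, V i := by
  rw [← Finset.prod_pow_eq_pow_sum]
  exact Ideal.prod_mem_prod fun i _ => Ideal.pow_mem_pow (hx i) _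

theorem monomialValue_mem {I : Ideal R} (hx : ∀ i, x i ∈ I) {V : σ →₀ ℕ} (hV : V ≠ 0) :
    monomialValue x V ∈ I := by
  obtain ⟨i, hi⟩ := Finsupp.ne_iff.1 hV
  have h : 1 ≤ ∑ i, V i :=
    (Nat.one_le_iff_ne_zero.2 hi).trans (Finset.single_le_sum (by simp) (Finset.mem_univ i))
  simpa using Ideal.pow_le_pow_right h (monomialValue_mem_pow hx V)

theorem monomialValue_mem_stripIdeal {P V : σ →₀ ℕ} {k : ℕ} (l : ℝ)
    (hl : ∀ i, (P i : ℝ) + l * D i ≤ V i) (hk : weight c P + k ≤ weight c V) :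
    monomialValue x V ∈ stripIdeal x D c P k :=
  Ideal.subset_span ⟨V, ⟨l, hl⟩, hk, rfl⟩

theorem stripIdeal_mono {D' : σ → ℝ} {P P' : σ →₀ ℕ} {k k' : ℕ}
    (h : ∀ l' : ℝ, ∃ l : ℝ, ∀ i, (P i : ℝ) + l * D i ≤ P' i + l' * D' i)
    (hk : weight c P + k ≤ weight c P' + k') :
    stripIdeal x D' c P' k' ≤ stripIdeal x D c P k := by
  refine Ideal.span_mono ?_
  rintro _ ⟨V, ⟨l', hl'⟩, hV, rfl⟩
  obtain ⟨l, hl⟩ := h l'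
  exact ⟨V, ⟨l, fun i => (hl i).trans (hl' i)⟩, hk.trans hV, rfl⟩

theorem stripIdeal_antitone (x : σ → R) (D : σ → ℝ) (c : σ → ℕ) (P : σ →₀ ℕ) :
    Antitone (stripIdeal x D c P) := fun _ _ h =>
  stripIdeal_mono (fun l => ⟨l, fun _ => le_rfl⟩) (by omega)

theorem stripIdeal_mul_le (x : σ → R) (D : σ → ℝ) (c : σ → ℕ) (P Q : σ →₀ ℕ) (i j : ℕ) :
    stripIdeal x D c P i * stripIdeal x D c Q j ≤ stripIdeal x D c (P + Q) (i + j) := by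
  rw [stripIdeal, stripIdeal, Ideal.span_mul_span', Ideal.span_le]
  rintro _ ⟨_, ⟨V, ⟨l, hl⟩, hV, rfl⟩, _, ⟨W, ⟨l', hl'⟩, hW, rfl⟩, rfl⟩
  simp only [← monomialValue_add]
  refine monomialValue_mem_stripIdeal (l + l') (fun i => ?_) ?_
  · have := hl i
    have := hl' i
    push_cast [Finsupp.add_apply]
    linarith
  · simp only [weight_add]
    omega

theorem stripIdeal_le_pow {I : Ideal R} (hx : ∀ i, x i ∈ I) (P : σ →₀ ℕ) (t : ℕ) :
    stripIdeal x D c P ((∑ i, c i) * t + 1) ≤ I ^ (t + 1) := by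
  rw [stripIdeal, Ideal.span_le]
  rintro _ ⟨V, -, hV, rfl⟩
  refine Ideal.pow_le_pow_right ?_ (monomialValue_mem_pow hx V)
  have h : weight c V ≤ (∑ i, c i) * ∑ i, V i := by
    rw [weight, Finset.sum_mul]
    exact Finset.sum_le_sum fun i hi =>
      Nat.mul_le_mul_left _ (Finset.single_le_sum (by simp) hi)
  by_contra! hlt
  have := Nat.mul_le_mul_left (∑ i, c i) (Nat.lt_succ_iff.1 hlt)
  omega

/-- Division of the monomials `x^V` on the side `l ≥ 0` of the strip through `C + P` by
`G = x^C` and `H = ∑ ρ_s x^(φ s)`. For `l ≤ 1`, `G` divides `x^V`. For `l > 1`, the term of `H` with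
exponent `Q` divides `x^V`, and the other terms of `x^(V - Q) H` have a smaller coordinate at
`i₀`, since they are closer to `P`, where that coordinate vanishes. -/
theorem monomialValue_mem_of_nonneg {α : Type*} {T : Finset α} {ρ : α → R} {φ : α → σ →₀ ℕ}
    {C P Q : σ →₀ ℕ} {q : α} (hq : q ∈ T) (hφq : φ q = Q) (hu : IsUnit (ρ q))
    (hφ : ∀ s ∈ T, ∃ μ : ℝ, 0 ≤ μ ∧ μ ≤ 1 ∧ ∀ i, (φ s i : ℝ) = P i + μ * ((Q i : ℝ) - P i))
    (hinj : ∀ s ∈ T, s ≠ q → φ s ≠ Q)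
    (hPQ : ∀ i, P i = 0 ∨ Q i = 0) {i₀ : σ} (hi₀ : 0 < Q i₀) (hc : weight c P = weight c Q) (k : ℕ)
    (V : σ →₀ ℕ) (l : ℝ) (hl0 : 0 ≤ l)
    (hl : ∀ i, (C i : ℝ) + P i + l * ((Q i : ℝ) - P i) ≤ V i)
    (hV : weight c C + weight c P + k ≤ weight c V) :
    monomialValue x V ∈
      Ideal.span {monomialValue x C} * stripIdeal x (fun i => (Q i : ℝ) - P i) c P k ⊔
      Ideal.span {∑ s ∈ T, ρ s * monomialValue x (φ s)} *
        stripIdeal x (fun i => (Q i : ℝ) - P i) c C k := by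
  classical
  set N := Ideal.span {monomialValue x C} * stripIdeal x (fun i => (Q i : ℝ) - P i) c P k ⊔
      Ideal.span {∑ s ∈ T, ρ s * monomialValue x (φ s)} *
        stripIdeal x (fun i => (Q i : ℝ) - P i) c C k with hN
  induction hm : V i₀ using Nat.strong_induction_on generalizing V l with
  | _ m ih =>
  rcases le_or_gt l 1 with hl1 | hl1
  · have hCV : C ≤ V := fun i => by
      have h1 : (0 : ℝ) ≤ P i := Nat.cast_nonneg _
      have h2 : (0 : ℝ) ≤ Q i := Nat.cast_nonneg _
      have h3 := mul_nonneg (sub_nonneg.2 hl1) h1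
      have h4 := mul_nonneg hl0 h2
      have : (C i : ℝ) ≤ V i := by linarith [hl i]
      exact_mod_cast this
    obtain ⟨W, rfl⟩ := exists_add_of_le hCV
    rw [monomialValue_add]
    refine Ideal.mem_sup_left (Ideal.mul_mem_mul (Ideal.mem_span_singleton_self _) ?_)
    refine monomialValue_mem_stripIdeal l (fun i => ?_) ?_
    · have := hl i
      push_cast [Finsupp.add_apply] at this
      linarith
    · rw [weight_add] at hV
      omega
  · have hQV : Q ≤ V := fun i => by
      rcases hPQ i with h | h
      · have h0 := hl i
        have h1 : (0 : ℝ) ≤ C i := Nat.cast_nonneg _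
        have h2 : (0 : ℝ) ≤ Q i := Nat.cast_nonneg _
        have h3 := mul_nonneg (sub_nonneg.2 hl1.le) h2
        rw [h, Nat.cast_zero] at h0
        have : (Q i : ℝ) ≤ V i := by linarith
        exact_mod_cast this
      · simp [h]
    obtain ⟨W, rfl⟩ := exists_add_of_le hQV
    have hW : ∀ i, (C i : ℝ) + (l - 1) * ((Q i : ℝ) - P i) ≤ W i := fun i => by
      have := hl i
      push_cast [Finsupp.add_apply] at this
      linarith
    have hφw : ∀ s ∈ T, weight c (φ s) = weight c P := fun s hs => by
      obtain ⟨μ, -, -, hμ⟩ := hφ s hs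
      have hc' : ∑ i, (c i : ℝ) * P i = ∑ i, (c i : ℝ) * Q i := by exact_mod_cast hc
      have : ∑ i, (c i : ℝ) * φ s i = ∑ i, (c i : ℝ) * P i := by
        calc ∑ i, (c i : ℝ) * φ s i
            = ∑ i, (c i : ℝ) * P i + μ * (∑ i, (c i : ℝ) * Q i - ∑ i, (c i : ℝ) * P i) := by
              rw [← Finset.sum_sub_distrib, Finset.mul_sum, ← Finset.sum_add_distrib]
              exact Finset.sum_congr rfl fun i _ => by rw [hμ]; ring
          _ = _ := by rw [hc']; ring
      unfold weight
      exact_mod_cast this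
    rw [weight_add, ← hc] at hV
    have hWmem : monomialValue x W ∈ stripIdeal x (fun i => (Q i : ℝ) - P i) c C k :=
      monomialValue_mem_stripIdeal (l - 1) hW (by omega)
    have hprod : (∑ s ∈ T, ρ s * monomialValue x (φ s)) * monomialValue x W ∈ N :=
      Ideal.mem_sup_right (Ideal.mul_mem_mul (Ideal.mem_span_singleton_self _) hWmem)
    have hrest : ∀ s ∈ T.erase q, ρ s * monomialValue x (φ s + W) ∈ N := fun s hs => by
      obtain ⟨hsq, hs⟩ := Finset.mem_erase.1 hs
      obtain ⟨μ, hμ0, hμ1, hμ⟩ := hφ s hs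
      have hP0 : P i₀ = 0 := (hPQ i₀).resolve_right hi₀.ne'
      have hμlt : μ < 1 := lt_of_le_of_ne hμ1 fun h => hinj s hs hsq <| Finsupp.ext fun i => by
        have := hμ i
        rw [h] at this
        have : (φ s i : ℝ) = Q i := by linarith
        exact_mod_cast this
      refine Ideal.mul_mem_left _ _ (ih ((φ s + W) i₀) ?_ (φ s + W) (l - 1 + μ) (by linarith)
        (fun i => ?_) ?_ rfl)
      · have h1 := hμ i₀
        have h2 : (0 : ℝ) < Q i₀ := by exact_mod_cast hi₀
        have h3 := mul_lt_mul_of_pos_right hμlt h2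
        rw [hP0, Nat.cast_zero] at h1
        have h4 : (φ s i₀ : ℝ) < Q i₀ := by linarith
        have h5 : φ s i₀ < Q i₀ := by exact_mod_cast h4
        rw [← hm, Finsupp.add_apply, Finsupp.add_apply]
        omega
      · have := hW i
        push_cast [Finsupp.add_apply]
        rw [hμ]
        linarith
      · rw [weight_add, hφw s hs]
        omega
    refine (Ideal.unit_mul_mem_iff_mem N hu).1 ?_
    have hsum : ρ q * monomialValue x (Q + W) =
        (∑ s ∈ T, ρ s * monomialValue x (φ s)) * monomialValue x W -
          ∑ s ∈ T.erase q, ρ s * monomialValue x (φ s + W) := by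
      rw [← Finset.add_sum_erase _ _ hq, add_mul, Finset.sum_mul, hφq]
      simp only [monomialValue_add, mul_assoc, add_sub_cancel_right]
    rw [hsum]
    exact sub_mem hprod (sum_mem hrest)

/-- The linear step of the Hensel argument: modulo elements of the same weight in the strips through
`P` and `C`, the two factors `G = x^C` and `H` of the edge polynomial generate the strip through
`C + P`. -/
theorem stripIdeal_add_le {α : Type*} {T : Finset α} {ρ : α → R} {φ : α → σ →₀ ℕ}
    {C P Q : σ →₀ ℕ} {p q : α} (hp : p ∈ T) (hφp : φ p = P) (hup : IsUnit (ρ p))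
    (hq : q ∈ T) (hφq : φ q = Q) (huq : IsUnit (ρ q))
    (hφ : ∀ s ∈ T, ∃ μ : ℝ, 0 ≤ μ ∧ μ ≤ 1 ∧ ∀ i, (φ s i : ℝ) = P i + μ * ((Q i : ℝ) - P i))
    (hinj : Set.InjOn φ T)
    (hPQ : ∀ i, P i = 0 ∨ Q i = 0) (hP : P ≠ 0) (hQ : Q ≠ 0) (hc : weight c P = weight c Q)
    (k : ℕ) :
    stripIdeal x (fun i => (Q i : ℝ) - P i) c (C + P) k ≤
      Ideal.span {monomialValue x C} * stripIdeal x (fun i => (Q i : ℝ) - P i) c P k ⊔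
      Ideal.span {∑ s ∈ T, ρ s * monomialValue x (φ s)} *
        stripIdeal x (fun i => (Q i : ℝ) - P i) c C k := by
  rw [stripIdeal, Ideal.span_le]
  rintro _ ⟨V, ⟨l, hl⟩, hV, rfl⟩
  rw [weight_add] at hV
  push_cast [Finsupp.add_apply] at hl
  rcases le_total 0 l with h0 | h0
  · obtain ⟨i₀, hi₀⟩ := Finsupp.ne_iff.1 hQ
    exact monomialValue_mem_of_nonneg hq hφq huq hφ
      (fun s hs hsq h => hsq (hinj hs hq (h.trans hφq.symm))) hPQ (Nat.pos_of_ne_zero hi₀) hc k V l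
      h0 hl hV
  · obtain ⟨i₀, hi₀⟩ := Finsupp.ne_iff.1 hP
    -- Read the edge from `Q` to `P`; the parameter `l` becomes `1 - l`.
    have := monomialValue_mem_of_nonneg (x := x) (C := C) hp hφp hup
      (fun s hs => by
        obtain ⟨μ, h0, h1, h⟩ := hφ s hs
        exact ⟨1 - μ, by linarith, by linarith, fun i => by rw [h]; ring⟩)
      (fun s hs hsp h => hsp (hinj hs hp (h.trans hφp.symm))) (fun i => (hPQ i).symm)
      (Nat.pos_of_ne_zero hi₀) hc.symm k V (1 - l) (by linarith)
      (fun i => by linarith [hl i]) (by omega)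
    refine SetLike.le_def.1 (sup_le_sup (Ideal.mul_mono_right ?_) (Ideal.mul_mono_right ?_)) this
    · exact stripIdeal_mono (fun l' => ⟨1 - l', fun i => by linarith⟩) (by omega)
    · exact stripIdeal_mono (fun l' => ⟨-l', fun i => by linarith⟩) (by omega)

end Strip

/-- A difference of exponents with coordinates of both signs is orthogonal to a positive integral
weight: take the total negative part on the positive coordinates and vice versa. -/
theorem exists_pos_weight_eq {σ : Type*} [Fintype σ] {A B : σ →₀ ℕ} (hpos : ∃ i, A i < B i)
    (hneg : ∃ j, B j < A j) : ∃ c : σ → ℕ, (∀ i, 0 < c i) ∧ weight c A = weight c B := by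
  set α := ∑ i, (B i - A i) with hα
  set β := ∑ i, (A i - B i) with hβ
  have hα0 : 0 < α := by
    obtain ⟨i, hi⟩ := hpos
    exact (Nat.sub_pos_of_lt hi).trans_le
      (Finset.single_le_sum (f := fun i => B i - A i) (by simp) (Finset.mem_univ i))
  have hβ0 : 0 < β := by
    obtain ⟨i, hi⟩ := hneg
    exact (Nat.sub_pos_of_lt hi).trans_le
      (Finset.single_le_sum (f := fun i => A i - B i) (by simp) (Finset.mem_univ i))
  refine ⟨fun i => if A i < B i then β else if B i < A i then α else 1, fun i => ?_, ?_⟩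
  · dsimp only
    split_ifs <;> omega
  · have key : ∑ i, ((if A i < B i then β else if B i < A i then α else 1) * A i
          + β * (B i - A i)) =
        ∑ i, ((if A i < B i then β else if B i < A i then α else 1) * B i
          + α * (A i - B i)) := by
      refine Finset.sum_congr rfl fun i _ => ?_
      split_ifs with h1 h2
      · rw [← mul_add, Nat.sub_eq_zero_of_le h1.le, Nat.add_sub_cancel' h1.le, mul_zero, add_zero]
      · rw [← mul_add, Nat.sub_eq_zero_of_le h2.le, Nat.add_sub_cancel' h2.le, mul_zero, add_zero]
      · have : A i = B i := by omega
        simp [this]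
    rw [Finset.sum_add_distrib, Finset.sum_add_distrib, ← Finset.mul_sum, ← Finset.mul_sum,
      ← hα, ← hβ, mul_comm β α] at key
    exact Nat.add_right_cancel key

/-! ### Loose edges of Newton polyhedra -/

section Polyhedron

variable {ι : Type*}

theorem subset_closedConvexHull_add_nonneg (K : Set (ι → ℝ)) :
    K ⊆ closedConvexHull ℝ (K + {v : ι → ℝ | ∀ i, 0 ≤ v i}) := fun s hs =>
  subset_closedConvexHull ⟨s, hs, 0, fun _ => le_rfl, add_zero s⟩

variable [Fintype ι]

theorem le_dotProduct_of_mem_closedConvexHull {K : Set (ι → ℝ)} {c : ι → ℝ} (hc : ∀ i, 0 ≤ c i)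
    {m : ℝ} (hm : ∀ s ∈ K, m ≤ dotProduct c s) {v : ι → ℝ}
    (hv : v ∈ closedConvexHull ℝ (K + {v : ι → ℝ | ∀ i, 0 ≤ v i})) : m ≤ dotProduct c v := by
  have hconv : Convex ℝ {w : ι → ℝ | m ≤ dotProduct c w} :=
    convex_halfSpace_ge (𝕜 := ℝ) (f := fun w => dotProduct c w)
      ⟨fun v w => dotProduct_add c v w, fun r v => dotProduct_smul r c v⟩ m
  have hclosed : IsClosed {w : ι → ℝ | m ≤ dotProduct c w} :=
    isClosed_le continuous_const (by unfold dotProduct; fun_prop)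
  refine closedConvexHull_min ?_ hconv hclosed hv
  rintro _ ⟨s, hs, u, hu, rfl⟩
  have h1 : 0 ≤ dotProduct c u := Finset.sum_nonneg fun i _ => mul_nonneg (hc i) (hu i)
  simp only [Set.mem_ofPred_eq, dotProduct_add]
  linarith [hm s hs]

/-- A positive linear form with a single minimiser among the generators has a single minimiser
on the polyhedron. -/
theorem eq_of_dotProduct_le {K : Set (ι → ℝ)} (hK : K.Finite) {c : ι → ℝ} (hc : ∀ i, 0 < c i)
    {s₀ : ι → ℝ} (hs₀ : ∀ s ∈ K, s ≠ s₀ → dotProduct c s₀ < dotProduct c s) {v : ι → ℝ}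
    (hv : v ∈ closedConvexHull ℝ (K + {v : ι → ℝ | ∀ i, 0 ≤ v i}))
    (hle : dotProduct c v ≤ dotProduct c s₀) : v = s₀ := by
  -- The cone `δ |w - s₀|₁ ≤ c · (w - s₀)` is closed and convex, and has apex `s₀`.
  obtain ⟨δ, hδ, hδc, hδK⟩ : ∃ δ : ℝ, 0 < δ ∧ (∀ i, δ ≤ c i) ∧
      ∀ s ∈ K, δ * ∑ i, |s i - s₀ i| ≤ dotProduct c s - dotProduct c s₀ := by
    have h1 : ∀ᶠ δ in nhdsWithin (0 : ℝ) (Set.Ioi 0), ∀ i, δ ≤ c i :=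
      Filter.eventually_all.2 fun i =>
        nhdsWithin_le_nhds ((eventually_lt_nhds (hc i)).mono fun _ h => h.le)
    have h2 : ∀ᶠ δ in nhdsWithin (0 : ℝ) (Set.Ioi 0), ∀ s ∈ K,
        δ * ∑ i, |s i - s₀ i| ≤ dotProduct c s - dotProduct c s₀ := by
      refine (Filter.eventually_all_finite hK).2 fun s hs => ?_
      by_cases h : s = s₀
      · simp [h]
      · have ht : Filter.Tendsto (fun δ : ℝ => δ * ∑ i, |s i - s₀ i|) (nhds 0) (nhds 0) := by
          have : Continuous fun δ : ℝ => δ * ∑ i, |s i - s₀ i| := by fun_prop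
          simpa using this.tendsto 0
        exact nhdsWithin_le_nhds
          ((ht.eventually_lt_const (sub_pos.2 (hs₀ s hs h))).mono fun _ h => h.le)
    obtain ⟨δ, ⟨h1, h2⟩, h0⟩ := ((h1.and h2).and self_mem_nhdsWithin).exists
    exact ⟨δ, h0, h1, h2⟩
  have key : v ∈ {w : ι → ℝ | δ * ∑ i, |w i - s₀ i| ≤ dotProduct c w - dotProduct c s₀} := by
    refine closedConvexHull_min ?_ ?_ ?_ hv
    · rintro _ ⟨s, hs, u, hu, rfl⟩
      have h1 : δ * ∑ i, |(s + u) i - s₀ i| ≤ δ * ∑ i, |s i - s₀ i| + δ * ∑ i, u i := by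
        rw [← mul_add, ← Finset.sum_add_distrib]
        refine mul_le_mul_of_nonneg_left (Finset.sum_le_sum fun i _ => ?_) hδ.le
        have := abs_add_le (s i - s₀ i) (u i)
        rw [abs_of_nonneg (hu i)] at this
        rwa [Pi.add_apply, add_sub_right_comm]
      have h2 : δ * ∑ i, u i ≤ dotProduct c u := by
        rw [Finset.mul_sum]
        exact Finset.sum_le_sum fun i _ => mul_le_mul_of_nonneg_right (hδc i) (hu i)
      simp only [Set.mem_ofPred_eq, dotProduct_add]
      linarith [hδK s hs]
    · intro w hw w' hw' a b ha hb hab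
      rw [Set.mem_ofPred_eq] at hw hw' ⊢
      rw [dotProduct_add, dotProduct_smul, dotProduct_smul, smul_eq_mul, smul_eq_mul]
      have h1 : ∑ i, |(a • w + b • w') i - s₀ i| ≤
          a * ∑ i, |w i - s₀ i| + b * ∑ i, |w' i - s₀ i| := by
        rw [Finset.mul_sum, Finset.mul_sum, ← Finset.sum_add_distrib]
        refine Finset.sum_le_sum fun i _ => ?_
        have h := abs_add_le (a * (w i - s₀ i)) (b * (w' i - s₀ i))
        rw [abs_mul, abs_mul, abs_of_nonneg ha, abs_of_nonneg hb] at h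
        have he : (a • w + b • w') i - s₀ i = a * (w i - s₀ i) + b * (w' i - s₀ i) := by
          rw [Pi.add_apply, Pi.smul_apply, Pi.smul_apply, smul_eq_mul, smul_eq_mul]
          linear_combination s₀ i * hab
        rwa [he]
      have h2 := mul_le_mul_of_nonneg_left h1 hδ.le
      have h3 := mul_le_mul_of_nonneg_left hw ha
      have h4 := mul_le_mul_of_nonneg_left hw' hb
      have h5 : dotProduct c s₀ = a * dotProduct c s₀ + b * dotProduct c s₀ := by
        rw [← add_mul, hab, one_mul]
      linarith
    · exact isClosed_le (by fun_prop) (by unfold dotProduct; fun_prop)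
  have h0 : ∑ i, |v i - s₀ i| ≤ 0 := by
    have : δ * ∑ i, |v i - s₀ i| ≤ 0 := le_trans key (by linarith)
    by_contra! h
    linarith [mul_pos hδ h]
  have h1 := (Finset.sum_eq_zero_iff_of_nonneg fun i _ => abs_nonneg _).1
    (le_antisymm h0 (Finset.sum_nonneg fun i _ => abs_nonneg (v i - s₀ i)))
  exact funext fun i => sub_eq_zero.1 (abs_eq_zero.1 (h1 i (Finset.mem_univ i)))

/-- A Farkas lemma for one unknown: the system `l D ≤ u` is solvable as soon as every
nonnegative form vanishing on `D` is nonnegative on `u`. -/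
theorem exists_mul_le_of_forall_dotProduct_nonneg {D u : ι → ℝ} (hD : ∃ i, 0 < D i)
    (h : ∀ w : ι → ℝ, (∀ i, 0 ≤ w i) → dotProduct w D = 0 → 0 ≤ dotProduct w u) :
    ∃ l : ℝ, ∀ i, l * D i ≤ u i := by
  classical
  obtain ⟨i₁, hi₁⟩ := hD
  have hsingle : ∀ (j : ι) (r : ℝ), 0 ≤ r → ∀ k, 0 ≤ (Pi.single j r : ι → ℝ) k := fun j r hr k => by
    rw [Pi.single_apply]
    split_ifs
    exacts [hr, le_rfl]
  obtain ⟨i, hi, hmin⟩ := Finset.exists_min_image (Finset.univ.filter fun i => 0 < D i)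
    (fun i => u i / D i) ⟨i₁, by simpa using hi₁⟩
  have hi : 0 < D i := by simpa using hi
  refine ⟨u i / D i, fun j => ?_⟩
  rcases lt_trichotomy (D j) 0 with hj | hj | hj
  · have := h (Pi.single i (-D j) + Pi.single j (D i))
      (fun k => add_nonneg (hsingle i _ (neg_nonneg.2 hj.le) k) (hsingle j _ hi.le k))
      (by simp only [add_dotProduct, single_dotProduct]; ring)
    simp only [add_dotProduct, single_dotProduct] at this
    rw [div_mul_eq_mul_div, div_le_iff₀ hi]
    linarith
  · have := h (Pi.single j 1) (hsingle j 1 zero_le_one)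
      (by simp [single_dotProduct, hj])
    simpa [single_dotProduct, hj] using this
  · have := hmin j (by simpa using hj)
    rwa [le_div_iff₀ hj] at this

end Polyhedron

/-- A loose edge has end points `A`, `B` among the generators, and all generators lie in the strip
`A + ℝ (B - A) + ℝⁿ_{≥0}`; those on the line `A B` lie on the segment `[A, B]`. -/
theorem exists_endpoints_of_isLooseEdge {n : ℕ} {K E : Set (Fin n → ℝ)} (hK : K.Finite)
    (hE : IsLooseEdge (closedConvexHull ℝ (K + {v : Fin n → ℝ | ∀ i, 0 ≤ v i})) E) :
    ∃ A ∈ K, ∃ B ∈ K, (∃ i, A i < B i) ∧ (∃ j, B j < A j) ∧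
      (∀ s ∈ K, ∃ l : ℝ, ∀ i, A i + l * (B i - A i) ≤ s i) ∧
      ∀ s ∈ K, ∀ l : ℝ, (∀ i, s i = A i + l * (B i - A i)) → 0 ≤ l ∧ l ≤ 1 := by
  set Δ := closedConvexHull ℝ (K + {v : Fin n → ℝ | ∀ i, 0 ≤ v i}) with hΔ
  obtain ⟨⟨⟨v₀, hv₀⟩, c, hc, hEc⟩, hdim, hloose⟩ := hE
  change E = {v | v ∈ Δ ∧ ∀ w ∈ Δ, dotProduct c v ≤ dotProduct c w} at hEc
  have hKΔ : K ⊆ Δ := subset_closedConvexHull_add_nonneg K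
  have hKne : K.Nonempty := by
    by_contra h
    rw [Set.not_nonempty_iff_eq_empty] at h
    have hv : v₀ ∈ Δ := by
      rw [hEc] at hv₀
      exact hv₀.1
    have := le_dotProduct_of_mem_closedConvexHull (K := K) (fun i => (hc i).le)
      (m := dotProduct c v₀ + 1) (by simp [h]) hv
    linarith
  obtain ⟨s₀, hs₀K, hs₀⟩ := Set.exists_min_image K (dotProduct c) hK hKne
  have hface : ∀ s ∈ K, dotProduct c s = dotProduct c s₀ → s ∈ E := fun s hs h => by
    rw [hEc]
    exact ⟨hKΔ hs, fun w hw => h ▸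
      le_dotProduct_of_mem_closedConvexHull (fun i => (hc i).le) hs₀ hw⟩
  obtain ⟨s₁, hs₁K, hs₁, hne⟩ : ∃ s₁ ∈ K, dotProduct c s₁ = dotProduct c s₀ ∧ s₁ ≠ s₀ := by
    by_contra! h
    have hE0 : E = {s₀} := by
      refine Set.eq_singleton_iff_unique_mem.2 ⟨hface s₀ hs₀K rfl, fun v hv => ?_⟩
      rw [hEc] at hv
      exact eq_of_dotProduct_le hK hc
        (fun s hs hne => lt_of_le_of_ne (hs₀ s hs) fun he => hne (h s hs he.symm))
        hv.1 (hv.2 s₀ (hKΔ hs₀K))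
    rw [hE0, faceDim, vectorSpan_singleton, finrank_bot] at hdim
    exact zero_ne_one hdim
  obtain ⟨i, hi⟩ := Function.ne_iff.1 hne
  have hKE : {s ∈ K | dotProduct c s = dotProduct c s₀}.Finite := hK.subset fun _ h => h.1
  -- The ends of the edge have the least and the greatest `i`-th coordinate.
  obtain ⟨A, ⟨hAK, hA⟩, hAmin⟩ := Set.exists_min_image _ (fun s => s i) hKE ⟨s₀, hs₀K, rfl⟩
  obtain ⟨B, ⟨hBK, hB⟩, hBmax⟩ := Set.exists_max_image _ (fun s => s i) hKE ⟨s₀, hs₀K, rfl⟩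
  have hAB : A i < B i := by
    have h1 := hAmin s₀ ⟨hs₀K, rfl⟩
    have h2 := hAmin s₁ ⟨hs₁K, hs₁⟩
    have h3 := hBmax s₀ ⟨hs₀K, rfl⟩
    have h4 := hBmax s₁ ⟨hs₁K, hs₁⟩
    rcases lt_or_gt_of_ne hi with h | h <;> linarith
  have hcD : dotProduct c (B - A) = 0 := by rw [dotProduct_sub, hA, hB, sub_self]
  -- A face of dimension at most one through `A` and `B` lies on the line `A B`.
  have line : ∀ F : Set (Fin n → ℝ), faceDim F ≤ 1 → A ∈ F → B ∈ F →
      ∀ v ∈ F, ∃ l : ℝ, v = A + l • (B - A) := by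
    intro F hF hAF hBF v hv
    obtain ⟨d, hd⟩ := (collinear_iff_of_mem hAF).1 (collinear_iff_finrank_le_one.2 hF)
    obtain ⟨r, hr⟩ := hd v hv
    obtain ⟨q, hq⟩ := hd B hBF
    have hq0 : q ≠ 0 := by
      rintro rfl
      rw [zero_smul, zero_vadd] at hq
      exact absurd hAB (hq ▸ lt_irrefl _)
    refine ⟨r / q, ?_⟩
    rw [hr, hq, vadd_eq_add, vadd_eq_add, add_sub_cancel_right, smul_smul, div_mul_cancel₀ r hq0,
      add_comm]
  have hEline := line E hdim.le (hface A hAK hA) (hface B hBK hB)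
  refine ⟨A, hAK, B, hBK, ⟨i, hAB⟩, ?_, ?_, ?_⟩
  · by_contra! h
    have : 0 < dotProduct c (B - A) :=
      Finset.sum_pos' (fun j _ => mul_nonneg (hc j).le (sub_nonneg.2 (h j)))
        ⟨i, Finset.mem_univ i, mul_pos (hc i) (sub_pos.2 hAB)⟩
    exact this.ne' hcD
  · intro s hs
    suffices ∃ l : ℝ, ∀ j, l * (B - A) j ≤ (s - A) j by
      obtain ⟨l, hl⟩ := this
      exact ⟨l, fun j => by have := hl j; simp only [Pi.sub_apply] at this; linarith⟩
    refine exists_mul_le_of_forall_dotProduct_nonneg ⟨i, sub_pos.2 hAB⟩ fun w hw hwD => ?_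
    by_contra! hneg
    -- Tilt `c` in the direction `w`, keeping it constant on the edge, until a new exponent
    -- reaches the minimum; the resulting face is larger than the edge.
    obtain ⟨s', ⟨hs'K, hs'neg⟩, hmin⟩ := Set.exists_min_image
      {s ∈ K | dotProduct w (s - A) < 0}
      (fun s => dotProduct c (s - A) / -dotProduct w (s - A))
      (hK.subset fun _ h => h.1) ⟨s, hs, hneg⟩
    set t := dotProduct c (s' - A) / -dotProduct w (s' - A) with ht
    have hcA : ∀ s ∈ K, 0 ≤ dotProduct c (s - A) := fun s hs => by
      rw [dotProduct_sub, hA]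
      exact sub_nonneg.2 (hs₀ s hs)
    have ht0 : 0 ≤ t := div_nonneg (hcA s' hs'K) (neg_nonneg.2 hs'neg.le)
    set c' := c + t • w with hc'
    have hc'pos : ∀ j, 0 < c' j := fun j => add_pos_of_pos_of_nonneg (hc j) (mul_nonneg ht0 (hw j))
    have hc'sub : ∀ v, dotProduct c' (v - A) = dotProduct c (v - A) + t * dotProduct w (v - A) :=
      fun v => by rw [hc', add_dotProduct, smul_dotProduct, smul_eq_mul]
    have hc'K : ∀ s ∈ K, dotProduct c' A ≤ dotProduct c' s := fun s hs => by
      rw [← sub_nonneg, ← dotProduct_sub, hc'sub]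
      rcases lt_or_ge (dotProduct w (s - A)) 0 with h | h
      · have := hmin s ⟨hs, h⟩
        rw [le_div_iff₀ (neg_pos.2 h)] at this
        linarith
      · exact add_nonneg (hcA s hs) (mul_nonneg ht0 h)
    have hs'eq : dotProduct c' s' = dotProduct c' A := by
      rw [← sub_eq_zero, ← dotProduct_sub, hc'sub, ht]
      have : -dotProduct w (s' - A) ≠ 0 := (neg_pos.2 hs'neg).ne'
      have h := div_mul_cancel₀ (dotProduct c (s' - A)) this
      linarith
    set F := {v | v ∈ Δ ∧ ∀ w ∈ Δ, dotProduct c' v ≤ dotProduct c' w} with hF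
    have hmemF : ∀ v ∈ Δ, dotProduct c' v = dotProduct c' A → v ∈ F := fun v hv h =>
      ⟨hv, fun u hu => h ▸
        le_dotProduct_of_mem_closedConvexHull (fun j => (hc'pos j).le) hc'K hu⟩
    have hAF : A ∈ F := hmemF A (hKΔ hAK) rfl
    have hEF : E ⊆ F := fun v hv => by
      obtain ⟨l, hl⟩ := hEline v hv
      refine hmemF v (by rw [hEc] at hv; exact hv.1) ?_
      rw [← sub_eq_zero, ← dotProduct_sub, hc'sub, hl, add_sub_cancel_left, dotProduct_smul,
        dotProduct_smul, hcD, hwD]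
      simp
    refine hloose F ⟨⟨A, hAF⟩, c', hc'pos, rfl⟩ ?_ hEF
    by_contra! hlt
    obtain ⟨l, hl⟩ := line F (by omega) hAF (hEF (hface B hBK hB)) s' (hmemF s' (hKΔ hs'K) hs'eq)
    rw [hl, add_sub_cancel_left, dotProduct_smul, hwD] at hs'neg
    simp at hs'neg
  · intro s hs l hl
    have hsA : s = A + l • (B - A) := funext fun j => by simp [hl j]
    have hcs : dotProduct c s = dotProduct c s₀ := by
      rw [hsA, dotProduct_add, dotProduct_smul, hcD, smul_zero, add_zero, hA]
    have h1 := hAmin s ⟨hs, hcs⟩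
    have h2 := hBmax s ⟨hs, hcs⟩
    simp only [hl i] at h1 h2
    have h3 := sub_pos.2 hAB
    constructor
    · by_contra! h
      linarith [mul_neg_of_neg_of_pos h h3]
    · by_contra! h
      linarith [mul_lt_mul_of_pos_right h h3]

/-- If every exponent lies above the line `A B` and `A`, `B` have disjoint supports, then
`{A}` and `{B}` are the only possible vertices. -/
theorem isVertex_eq_or_eq {n : ℕ} {K V : Set (Fin n → ℝ)}
    (hK0 : ∀ s ∈ K, ∀ i, 0 ≤ s i) {A B : Fin n → ℝ} (hA : A ∈ K) (hB : B ∈ K)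
    (hstrip : ∀ s ∈ K, ∃ l : ℝ, ∀ i, A i + l * (B i - A i) ≤ s i)
    (hAB : ∀ i, A i = 0 ∨ B i = 0)
    (hV : IsVertex (closedConvexHull ℝ (K + {v : Fin n → ℝ | ∀ i, 0 ≤ v i})) V) :
    V = {A} ∨ V = {B} := by
  set Δ := closedConvexHull ℝ (K + {v : Fin n → ℝ | ∀ i, 0 ≤ v i}) with hΔ
  obtain ⟨⟨-, c, hc, hVc⟩, hdim⟩ := hV
  change V = {v | v ∈ Δ ∧ ∀ w ∈ Δ, dotProduct c v ≤ dotProduct c w} at hVc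
  have hKΔ : K ⊆ Δ := subset_closedConvexHull_add_nonneg K
  have hsub : V.Subsingleton := by
    rw [faceDim, Submodule.finrank_eq_zero, vectorSpan_eq_bot_iff_subsingleton] at hdim
    exact hdim
  have hmono : ∀ v w : Fin n → ℝ, (∀ i, v i ≤ w i) → dotProduct c v ≤ dotProduct c w :=
    fun v w h => Finset.sum_le_sum fun i _ => mul_le_mul_of_nonneg_left (h i) (hc i).le
  have hmin : ∀ s ∈ K, dotProduct c A ≤ dotProduct c s ∨ dotProduct c B ≤ dotProduct c s := by
    intro s hs
    obtain ⟨l, hl⟩ := hstrip s hs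
    rcases lt_or_ge l 0 with h0 | h0
    · refine .inl (hmono _ _ fun i => ?_)
      rcases hAB i with h | h
      · exact h ▸ hK0 s hs i
      · have h1 := hl i
        rw [h] at h1
        have := mul_nonneg (neg_nonneg.2 h0.le) (hK0 A hA i)
        linarith
    rcases lt_or_ge 1 l with h1 | h1
    · refine .inr (hmono _ _ fun i => ?_)
      rcases hAB i with h | h
      · have h2 := hl i
        rw [h] at h2
        have := mul_nonneg (sub_nonneg.2 h1.le) (hK0 B hB i)
        linarith
      · exact h ▸ hK0 s hs i
    · have h2 : dotProduct c (A + l • (B - A)) ≤ dotProduct c s := hmono _ _ hl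
      rw [dotProduct_add, dotProduct_smul, dotProduct_sub, smul_eq_mul] at h2
      by_contra! h
      rcases le_total (dotProduct c A) (dotProduct c B) with h3 | h3
      · linarith [mul_nonneg h0 (sub_nonneg.2 h3)]
      · linarith [mul_nonneg (sub_nonneg.2 h1) (sub_nonneg.2 h3)]
  have hVmem : ∀ P ∈ K, (∀ s ∈ K, dotProduct c P ≤ dotProduct c s) → V = {P} := fun P hP h => by
    refine (Set.subsingleton_iff_singleton ?_).1 hsub
    rw [hVc]
    exact ⟨hKΔ hP, fun w hw => le_dotProduct_of_mem_closedConvexHull (fun i => (hc i).le) h hw⟩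
  rcases le_total (dotProduct c A) (dotProduct c B) with h | h
  · exact .inl (hVmem A hA fun s hs => (hmin s hs).elim id h.trans)
  · exact .inr (hVmem B hB fun s hs => (hmin s hs).elim h.trans id)

/-! ### Factorization along a loose edge -/

/-- If all exponents of `p` lie in the strip through `A` and `B`, with unit coefficients, and the edge
polynomial has a nontrivial monomial factor `x^(A ⊓ B)`, then splitting off that factor lifts to a
nontrivial factorization in the completion. -/
theorem not_irreducible_of_strip {σ R : Type*} [Fintype σ] [CommRing R] {I : Ideal R}
    (hI : I ≠ ⊤) {x : σ → R} (hx : ∀ i, x i ∈ I) (p : MvPolynomial σ R)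
    (hp : ∀ s ∈ p.support, IsUnit (p.coeff s)) {A B : σ →₀ ℕ} (hA : A ∈ p.support)
    (hB : B ∈ p.support) (hpos : ∃ i, A i < B i) (hneg : ∃ j, B j < A j)
    (hstrip : ∀ s ∈ p.support, ∃ l : ℝ, ∀ i, (A i : ℝ) + l * ((B i : ℝ) - A i) ≤ s i)
    (hedge : ∀ s ∈ p.support, ∀ l : ℝ, (∀ i, (s i : ℝ) = A i + l * ((B i : ℝ) - A i)) →
      0 ≤ l ∧ l ≤ 1)
    (hAB : A ⊓ B ≠ 0) :
    ¬ Irreducible (algebraMap R (AdicCompletion I R) (MvPolynomial.eval x p)) := by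
  classical
  obtain ⟨c, hc, hcAB⟩ := exists_pos_weight_eq hpos hneg
  obtain ⟨P, hP⟩ := exists_add_of_le (inf_le_left : A ⊓ B ≤ A)
  obtain ⟨Q, hQ⟩ := exists_add_of_le (inf_le_right : A ⊓ B ≤ B)
  set C := A ⊓ B with hC
  have hAi : ∀ i, A i = C i + P i := fun i => by rw [hP, Finsupp.add_apply]
  have hBi : ∀ i, B i = C i + Q i := fun i => by rw [hQ, Finsupp.add_apply]
  have hCi : ∀ i, C i = min (A i) (B i) := fun i => by rw [hC, Finsupp.inf_apply]
  have hPQ : ∀ i, P i = 0 ∨ Q i = 0 := fun i => by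
    have h1 := hAi i
    have h2 := hBi i
    have h3 := hCi i
    omega
  have hP0 : P ≠ 0 := by
    rintro rfl
    obtain ⟨j, hj⟩ := hneg
    have h1 := hAi j
    have h2 := hBi j
    rw [Finsupp.zero_apply] at h1
    omega
  have hQ0 : Q ≠ 0 := by
    rintro rfl
    obtain ⟨j, hj⟩ := hpos
    have h1 := hAi j
    have h2 := hBi j
    rw [Finsupp.zero_apply] at h2
    omega
  have hD : ∀ i, (B i : ℝ) - A i = Q i - P i := fun i => by
    rw [hAi, hBi]
    push_cast
    ring
  have hcPQ : weight c P = weight c Q := by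
    have : weight c C + weight c P = weight c C + weight c Q := by
      rw [← weight_add, ← weight_add, ← hP, ← hQ, hcAB]
    exact Nat.add_left_cancel this
  -- The exponents of the edge.
  set T := p.support.filter fun s => ∃ l : ℝ, ∀ i, (s i : ℝ) = A i + l * ((B i : ℝ) - A i) with hT
  have hAT : A ∈ T := Finset.mem_filter.2 ⟨hA, 0, fun i => by ring⟩
  have hBT : B ∈ T := Finset.mem_filter.2 ⟨hB, 1, fun i => by ring⟩
  have hTl : ∀ s ∈ T, ∃ μ : ℝ, 0 ≤ μ ∧ μ ≤ 1 ∧ ∀ i, (s i : ℝ) = A i + μ * ((B i : ℝ) - A i) := by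
    intro s hs
    obtain ⟨hs, l, hl⟩ := Finset.mem_filter.1 hs
    obtain ⟨h0, h1⟩ := hedge s hs l hl
    exact ⟨l, h0, h1, hl⟩
  have hCs : ∀ s ∈ T, C ≤ s := by
    intro s hs i
    obtain ⟨μ, h0, h1, h⟩ := hTl s hs
    have e1 := mul_nonneg h0 (Nat.cast_nonneg (α := ℝ) (Q i))
    have e2 := mul_nonneg (sub_nonneg.2 h1) (Nat.cast_nonneg (α := ℝ) (P i))
    have e3 := h i
    rw [hD, hAi] at e3
    push_cast at e3
    have : (C i : ℝ) ≤ s i := by linarith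
    exact_mod_cast this
  have hφ : ∀ s ∈ T, ∃ μ : ℝ, 0 ≤ μ ∧ μ ≤ 1 ∧
      ∀ i, ((s - C : σ →₀ ℕ) i : ℝ) = P i + μ * ((Q i : ℝ) - P i) := by
    intro s hs
    obtain ⟨μ, h0, h1, h⟩ := hTl s hs
    refine ⟨μ, h0, h1, fun i => ?_⟩
    rw [Finsupp.tsub_apply, Nat.cast_sub (hCs s hs i), h, hD, hAi]
    push_cast
    ring
  set H := ∑ s ∈ T, p.coeff s * monomialValue x (s - C) with hH
  have hsplit := fun k => stripIdeal_add_le (x := x) (C := C) (T := T) (ρ := fun s => p.coeff s)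
    (φ := fun s => s - C) hAT (P := P) (tsub_eq_of_eq_add_rev hP) (hp A hA) hBT (Q := Q)
    (tsub_eq_of_eq_add_rev hQ) (hp B hB) hφ
    (fun s hs s' hs' h => by
      rw [← add_tsub_cancel_of_le (hCs s hs), ← add_tsub_cancel_of_le (hCs s' hs')]
      exact congrArg (C + ·) h) hPQ hP0 hQ0 hcPQ k
  have hf : MvPolynomial.eval x p - monomialValue x C * H ∈
      stripIdeal x (fun i => (Q i : ℝ) - P i) c (C + P) 1 := by
    have h1 : monomialValue x C * H = ∑ s ∈ T, p.coeff s * monomialValue x s := by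
      rw [hH, Finset.mul_sum]
      refine Finset.sum_congr rfl fun s hs => ?_
      rw [mul_left_comm, ← monomialValue_add, add_tsub_cancel_of_le (hCs s hs)]
    have h2 : MvPolynomial.eval x p = ∑ s ∈ p.support, p.coeff s * monomialValue x s :=
      MvPolynomial.eval_eq' x p
    rw [h1, h2, hT, ← Finset.sum_filter_add_sum_filter_not p.support
      (fun s => ∃ l : ℝ, ∀ i, (s i : ℝ) = A i + l * ((B i : ℝ) - A i)), add_sub_cancel_left]
    refine sum_mem fun s hs => Ideal.mul_mem_left _ _ ?_
    obtain ⟨hs, hne⟩ := Finset.mem_filter.1 hs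
    obtain ⟨l, hl⟩ := hstrip s hs
    refine monomialValue_mem_stripIdeal l (fun i => by rw [← hP, ← hD]; exact hl i) ?_
    -- An exponent off the line `A B` has strictly larger weight than `A`.
    rw [← hP, Nat.add_one_le_iff]
    have hcD : ∑ i, (c i : ℝ) * ((B i : ℝ) - A i) = 0 := by
      simp only [mul_sub, Finset.sum_sub_distrib]
      rw [sub_eq_zero]
      unfold weight at hcAB
      exact_mod_cast hcAB.symm
    have hlt : ∑ i, (c i : ℝ) * (A i + l * ((B i : ℝ) - A i)) < ∑ i, (c i : ℝ) * s i := by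
      push Not at hne
      obtain ⟨j, hj⟩ := hne l
      exact Finset.sum_lt_sum (fun i _ => mul_le_mul_of_nonneg_left (hl i) (Nat.cast_nonneg _))
        ⟨j, Finset.mem_univ j, mul_lt_mul_of_pos_left (lt_of_le_of_ne (hl j) hj.symm)
          (Nat.cast_pos.2 (hc j))⟩
    have heq : ∑ i, (c i : ℝ) * (A i + l * ((B i : ℝ) - A i)) = ∑ i, (c i : ℝ) * A i := by
      simp only [mul_add, mul_left_comm _ l, Finset.sum_add_distrib, ← Finset.mul_sum]
      rw [hcD, mul_zero, add_zero]
    rw [heq] at hlt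
    unfold weight
    exact_mod_cast hlt
  have hHI : H ∈ I := by
    refine sum_mem fun s hs => Ideal.mul_mem_left _ _ (monomialValue_mem hx fun h0 => ?_)
    obtain ⟨μ, h0', h1', h⟩ := hφ s hs
    -- A constant term of `H` would force `μ = 1` on the support of `P` and `μ = 0` on that of `Q`.
    obtain ⟨i, hi⟩ := Finsupp.ne_iff.1 hP0
    obtain ⟨j, hj⟩ := Finsupp.ne_iff.1 hQ0
    have hi' : (P i : ℝ) ≠ 0 := Nat.cast_ne_zero.2 hi
    have hj' : (Q j : ℝ) ≠ 0 := Nat.cast_ne_zero.2 hj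
    have e1 := h i
    have e2 := h j
    rw [h0, (hPQ i).resolve_left hi, Finsupp.zero_apply, Nat.cast_zero] at e1
    rw [h0, (hPQ j).resolve_right hj, Finsupp.zero_apply, Nat.cast_zero] at e2
    have e3 : μ = 0 := (mul_eq_zero.1 (by linarith : μ * (Q j : ℝ) = 0)).resolve_right hj'
    rw [e3] at e1
    exact hi' (by linarith)
  obtain ⟨g, h, hgh, hg, hh⟩ := exists_factorization_adicCompletion (I := I)
    (stripIdeal_antitone x _ c C) (stripIdeal_antitone x _ c P) (stripIdeal_antitone x _ c (C + P))
    (stripIdeal_mul_le x _ c C P) hsplit hf (stripIdeal_le_pow hx C) (stripIdeal_le_pow hx P)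
    (stripIdeal_le_pow hx (C + P)) (monomialValue_mem hx hAB) hHI
  exact not_irreducible_of_evalₐ_one_eq_zero hI hgh hg hh

theorem corollary1p2 {R : Type*} [CommRing R] [IsRegularLocalRing R] {n : ℕ}
    (x : Fin n → R) (hx : IsRegularSystemOfParameters x)
    (f : R) (Δ : Set (Fin n → ℝ)) (hΔ : IsNewtonPolyhedron x f Δ)
    (hloose : ∃ E : Set (Fin n → ℝ), IsLooseEdge Δ E)
    (hvert : 3 ≤ {V : Set (Fin n → ℝ) | IsVertex Δ V}.encard) :
    ¬ Irreducible
      (algebraMap R (AdicCompletion (IsLocalRing.maximalIdeal R) R) f) := by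
  obtain ⟨p, ⟨rfl, hp⟩, rfl⟩ := hΔ
  obtain ⟨E, hE⟩ := hloose
  have hK : (exponentPoints p).Finite := by
    refine (p.support.finite_toSet.image fun A : Fin n →₀ ℕ => fun i => (A i : ℝ)).subset ?_
    rintro _ ⟨A, hA, rfl⟩
    exact ⟨A, MvPolynomial.mem_support_iff.2 hA, rfl⟩
  have hmem : ∀ A ∈ p.support, (fun i => (A i : ℝ)) ∈ exponentPoints p := fun A hA =>
    ⟨A, MvPolynomial.mem_support_iff.1 hA, rfl⟩
  obtain ⟨_, hAK, _, hBK, ⟨i, hi⟩, ⟨j, hj⟩, hstrip, hedge⟩ := exists_endpoints_of_isLooseEdge hK hE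
  obtain ⟨A, hA, rfl⟩ := id hAK
  obtain ⟨B, hB, rfl⟩ := id hBK
  refine not_irreducible_of_strip (Ideal.IsPrime.ne_top') (fun i => ?_) p
    (fun s hs => (hp s).resolve_left (MvPolynomial.mem_support_iff.1 hs))
    (MvPolynomial.mem_support_iff.2 hA) (MvPolynomial.mem_support_iff.2 hB)
    ⟨i, Nat.cast_lt.1 hi⟩ ⟨j, Nat.cast_lt.1 hj⟩ (fun s hs => hstrip _ (hmem s hs))
    (fun s hs => hedge _ (hmem s hs)) fun hAB => ?_
  · rw [← hx.1]
    exact Ideal.subset_span ⟨i, rfl⟩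
  · have hsub : {V | IsVertex (closedConvexHull ℝ
        (exponentPoints p + {v : Fin n → ℝ | ∀ i, 0 ≤ v i})) V} ⊆
        {{fun i => (A i : ℝ)}, {fun i => (B i : ℝ)}} := fun V hV =>
      isVertex_eq_or_eq (by rintro _ ⟨s, -, rfl⟩ i; exact Nat.cast_nonneg _) hAK hBK hstrip
        (fun i => by
          have := DFunLike.congr_fun hAB i
          rw [Finsupp.inf_apply, Finsupp.zero_apply] at this
          rw [Nat.cast_eq_zero, Nat.cast_eq_zero]
          omega) hV
    have h2 := (Set.encard_le_encard hsub).trans (Set.encard_insert_le _ _)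
    rw [Set.encard_singleton, one_add_one_eq_two] at h2
    exact absurd (hvert.trans h2) (by norm_num)
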